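/- Let $k$ be an algebraically closed field of characteristic zero. For $q\in k^\times$ with $q^2\neq 1$ and integers $e,N\ge 1$ let $U(q;e,N)$ be the associative unital $k$-algebra generated by $E,F,K,K^{-1}$ subject to $$KK^{-1}=K^{-1}K=1,\quad KEK^{-1}=q^{2}E,\quad KFK^{-1}=q^{-2}F,\quad EF-FE=\frac{K-K^{-1}}{q-q^{-1}},\quad E^{e}=F^{e}=0,\quad K^{N}=1.$$ For $q$ a primitive $l$-th root of unity with $l\ge 3$ odd, the small quantum group is the algebra $\mathbf u_q(\mathfrak{sl}_2)=U(q;l,l)$. For $p\ge 2$ and $q\in k$ such that $q^2$ is a primitive $p$-th root of unity (for example, $q$ a primitive $2p$-th root of unity), the restricted quantum universal enveloping algebra is the algebra $\mathfrak U_q(\mathfrak{sl}_2)=U(q;p,2p)$. The basic algebra $\mathcal B(A)$ of a finite-dimensional $k$-algebra $A$ is the algebra $eAe$ with unit $e$, where $1=\varepsilon_1+\dots+\varepsilon_n$ is a decomposition into pairwise orthogonal primitive idempotents and $e$ is the sum of those $\varepsilon_j$ with $j$ in a set containing exactly one index for each isomorphism class among the left modules $A\varepsilon_1,\dots,A\varepsilon_n$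 (up to isomorphism of algebras, $\mathcal B(A)$ does not depend on the choices). **Proposition 2.16.** Neither the basic algebra $\mathcal B(\mathbf u_q(\mathfrak{sl}_2))$ nor the basic algebra $\mathcal B(\mathfrak U_q(\mathfrak{sl}_2))$ admits a Hopf algebra structure: there are no comultiplication, counit and antipode that make the given $k$-algebra a Hopf algebra over $k$. -/

import Mathlib

/-! ### The quantum algebras -/

/-- Names of the generators `E`, `F`, `K`, `K⁻¹`. -/
inductive QSl2Gen : Type
  | E | F | K | Kinv

namespace QSl2

variable {k : Type*} [Field k]

/-- A generator, inside the free `k`-algebra on the four names. -/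
abbrev gen (k : Type*) [Field k] (g : QSl2Gen) : FreeAlgebra k QSl2Gen := FreeAlgebra.ι k g

/-- The relations of a truncation of `U_q(sl₂)`:
`K K⁻¹ = K⁻¹ K = 1`, `K E K⁻¹ = q² E`, `K F K⁻¹ = q⁻² F`, `E F - F E = (K - K⁻¹) / (q - q⁻¹)`,
together with `E ^ e = F ^ e = 0` and `K ^ N = 1`. -/
inductive Rel (q : k) (e N : ℕ) : FreeAlgebra k QSl2Gen → FreeAlgebra k QSl2Gen → Prop
  | K_mul_Kinv : Rel q e N (gen k .K * gen k .Kinv) 1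
  | Kinv_mul_K : Rel q e N (gen k .Kinv * gen k .K) 1
  | K_E : Rel q e N (gen k .K * gen k .E * gen k .Kinv) (q ^ 2 • gen k .E)
  | K_F : Rel q e N (gen k .K * gen k .F * gen k .Kinv) ((q ^ 2)⁻¹ • gen k .F)
  | E_F : Rel q e N (gen k .E * gen k .F - gen k .F * gen k .E)
      ((q - q⁻¹)⁻¹ • (gen k .K - gen k .Kinv))
  | E_pow : Rel q e N (gen k .E ^ e) 0
  | F_pow : Rel q e N (gen k .F ^ e) 0
  | K_pow : Rel q e N (gen k .K ^ N) 1

end QSl2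

/-- The `k`-algebra generated by `E, F, K, K⁻¹` subject to the relations `QSl2.Rel q e N`. -/
abbrev TruncatedQSl2 {k : Type*} [Field k] (q : k) (e N : ℕ) : Type _ :=
  RingQuot (QSl2.Rel q e N)

/-- The small quantum group `u_q(sl₂)` (as an algebra), intended for `q` a primitive `l`-th root
of unity with `l ≥ 3` odd: `E ^ l = F ^ l = 0`, `K ^ l = 1`. -/
abbrev SmallQuantumGroupSl2 {k : Type*} [Field k] (q : k) (l : ℕ) : Type _ :=
  TruncatedQSl2 q l l

/-- The restricted quantum universal enveloping algebra of `sl₂` (as an algebra), intended for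
`q` with `q ^ 2` a primitive `p`-th root of unity, `p ≥ 2`: `E ^ p = F ^ p = 0`,
`K ^ (2 p) = 1`. -/
abbrev RestrictedQuantumGroupSl2 {k : Type*} [Field k] (q : k) (p : ℕ) : Type _ :=
  TruncatedQSl2 q p (2 * p)

/-! ### Basic algebras -/

/-- `e` is a primitive idempotent: a nonzero idempotent which is not a sum of two nonzero
orthogonal idempotents. -/
def IsPrimitiveIdempotent {A : Type*} [Ring A] (e : A) : Prop :=
  e ≠ 0 ∧ IsIdempotentElem e ∧
    ∀ a b : A, IsIdempotentElem a → IsIdempotentElem b → a * b = 0 → b * a = 0 → e = a + b →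
      a = 0 ∨ b = 0

/-- `e = ∑ i ∈ s, ε i`, where `1 = ∑ i, ε i` is a decomposition into pairwise orthogonal primitive
idempotents and `s` picks exactly one `j` for each isomorphism class of left modules `A ε i`.
(`Ideal.span {ε i}` is the left ideal `A ε i`.) -/
def IsBasicIdempotent {A : Type*} [Ring A] (e : A) : Prop :=
  ∃ (n : ℕ) (ε : Fin n → A) (s : Finset (Fin n)),
    CompleteOrthogonalIdempotents ε ∧
    (∀ i, IsPrimitiveIdempotent (ε i)) ∧
    (∀ i, ∃! j, j ∈ s ∧ Nonempty (Ideal.span {ε i} ≃ₗ[A] Ideal.span {ε j})) ∧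
    e = ∑ j ∈ s, ε j

/-- `B` is (a copy of) the basic algebra of `A`: for some `e` as in `IsBasicIdempotent`, the
algebra `B` is isomorphic to the algebra `e A e` (whose unit is `e`), through a multiplicative
`k`-linear injection `φ : B → A` with image `e A e`. -/
def IsBasicAlgebraOf (k A B : Type*) [Field k] [Ring A] [Algebra k A] [Ring B] [Algebra k B] :
    Prop :=
  ∃ (e : A) (φ : B →ₙₐ[k] A), IsBasicIdempotent e ∧
    Function.Injective φ ∧ Set.range φ = Set.range (fun a : A => e * a * e)

/-! ### Hopf structures on a given algebra -/

/-- There are a comultiplication, a counit and an antipode which make the given `k`-algebra `B`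
a Hopf algebra over `k` (with its given multiplication, unit and scalar action). -/
def AdmitsHopfStructure (k B : Type*) [Field k] [Ring B] [inst : Algebra k B] : Prop :=
  ∃ h : HopfAlgebra k B, h.toAlgebra = inst

/-!
A Hopf algebra `B` has plenty of automorphisms: for a character `χ` the winding map
`b ↦ ∑ χ(b₁) b₂` is an algebra automorphism, and it carries the counit to `χ`. So these maps
permute the characters of `B` transitively, and if one character is a projective `B`-module, then
all are (`exists_eigenvector_of_character`).

Let `A = U(q; p, N)`, where `q²` has order `p ≥ 2` and `q ^ N = 1`; this covers both families. Its
Steinberg module, of dimension `p` and highest weight `q⁻¹`, is simple, and it is projective: it is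
the left ideal of an explicit idempotent `f` proportional to `F^(p-1) E^(p-1) P`, with `P` a
projection to an eigenspace of `K` (`QSl2.exists_steinberg_idempotent`). In a basic algebra
`B = e A e` exactly one primitive idempotent belongs to it, and it gives a projective character of
`B` (`IsBasicIdempotent.exists_eigenvector`). The trivial character of `A` restricts to another
character of `B`. If `B` were a Hopf algebra, this one would be projective too, and hence so would
be the trivial `A`-module (`IsBasicAlgebraOf.exists_eigenvector`). But the highest weight module of
weight `1` is a nonsplit extension of the trivial module (`QSl2.not_exists_trivial_summand`).

The highest weight modules are needed as explicit representations, since the algebra is given by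
generators and relations; they also show that the elements constructed in it are nonzero.
-/

/-! ### Winding automorphisms of a Hopf algebra -/

section Winding

open Coalgebra TensorProduct WithConv

variable {k B : Type*} [Field k] [Ring B] [HopfAlgebra k B]

/-- The winding endomorphism `b ↦ ∑ f(b₁) b₂` attached to a linear form `f`. -/
noncomputable def windingMap (f : B →ₗ[k] k) : B →ₗ[k] B :=
  (TensorProduct.lid k B).toLinearMap ∘ₗ f.rTensor B ∘ₗ comul

theorem windingMap_counit : windingMap (counit : B →ₗ[k] k) = LinearMap.id := by
  ext b
  simp [windingMap]

theorem windingMap_comp (f g : B →ₗ[k] k) :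
    windingMap g ∘ₗ windingMap f = windingMap (toConv f * toConv g).ofConv := by
  ext b
  have h := congrArg (fun t => TensorProduct.lid k B (TensorProduct.lid k (k ⊗[k] B)
    (TensorProduct.map f (TensorProduct.map g LinearMap.id) t))) (coassoc_apply (R := k) b)
  have key : ∀ t : B ⊗[k] B, windingMap g (TensorProduct.lid k B (f.rTensor B t)) =
      TensorProduct.lid k B (TensorProduct.lid k (k ⊗[k] B)
        (TensorProduct.map f (TensorProduct.map g LinearMap.id) (comul.lTensor B t))) := by
    intro t
    induction t with
    | zero => simp
    | add x y hx hy => simp only [map_add, hx, hy]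
    | tmul x y => simp [windingMap, LinearMap.rTensor]
  have key2 : ∀ t : (B ⊗[k] B) ⊗[k] B,
      TensorProduct.lid k B (TensorProduct.lid k (k ⊗[k] B)
        (TensorProduct.map f (TensorProduct.map g LinearMap.id) (TensorProduct.assoc k B B B t)))
      = TensorProduct.lid k B ((LinearMap.mul' k k ∘ₗ TensorProduct.map f g).rTensor B t) := by
    intro t
    induction t with
    | zero => simp
    | add x y hx hy => simp only [map_add, hx, hy]
    | tmul x z =>
      induction x with
      | zero => simp
      | add x y hx hy => simp only [TensorProduct.add_tmul, map_add, hx, hy]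
      | tmul x y => simp [mul_smul]
  rw [LinearMap.comp_apply]
  conv_lhs => rw [windingMap.eq_def f]
  simp only [LinearMap.comp_apply, LinearEquiv.coe_coe]
  rw [key, ← h, key2, windingMap]
  simp only [LinearMap.comp_apply, LinearEquiv.coe_coe, LinearMap.convMul_def, ofConv_toConv,
    LinearMap.rTensor_comp]

theorem windingMap_mul (χ : B →ₐ[k] k) (a b : B) :
    windingMap χ.toLinearMap (a * b) = windingMap χ.toLinearMap a * windingMap χ.toLinearMap b := by
  have h : ∀ b, windingMap χ.toLinearMap b =
      Algebra.TensorProduct.lid k B (Algebra.TensorProduct.map χ (AlgHom.id k B) (comul b)) :=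
    fun b => rfl
  simp [h]

theorem counit_windingMap (f : B →ₗ[k] k) (b : B) : counit (R := k) (windingMap f b) = f b := by
  have key : ∀ t : B ⊗[k] B, counit (R := k) (TensorProduct.lid k B (f.rTensor B t)) =
      f (TensorProduct.rid k B (counit.lTensor B t)) := by
    intro t
    induction t with
    | zero => simp
    | add x y hx hy => simp only [map_add, hx, hy]
    | tmul x y => simp [mul_comm]
  simpa [windingMap] using key (comul b)

/-- The winding endomorphism of a character is invertible: its inverse is the one attached to
the composite of the character with the antipode. -/
theorem windingMap_bijective (χ : B →ₐ[k] k) : Function.Bijective (windingMap χ.toLinearMap) := by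
  have h1 := LinearMap.algHom_comp_convMul_distrib χ (toConv LinearMap.id)
    (toConv (HopfAlgebra.antipode k (A := B)))
  have h2 := LinearMap.algHom_comp_convMul_distrib χ
    (toConv (HopfAlgebra.antipode k (A := B))) (toConv LinearMap.id)
  have hone : χ.toLinearMap ∘ₗ (1 : WithConv (B →ₗ[k] B)).ofConv = counit := by
    ext b
    simp
  rw [LinearMap.id_mul_antipode, hone] at h1
  rw [LinearMap.antipode_mul_id, hone] at h2
  have e1 := windingMap_comp χ.toLinearMap (χ.toLinearMap ∘ₗ HopfAlgebra.antipode k (A := B))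
  have e2 := windingMap_comp (χ.toLinearMap ∘ₗ HopfAlgebra.antipode k (A := B)) χ.toLinearMap
  simp only [LinearMap.comp_id] at h1 h2
  rw [← h1, windingMap_counit] at e1
  rw [← h2, windingMap_counit] at e2
  exact Function.bijective_iff_has_inverse.2
    ⟨_, fun b => LinearMap.congr_fun e1 b, fun b => LinearMap.congr_fun e2 b⟩

/-- Over a Hopf algebra, an eigenvector for left multiplication with eigencharacter `χ` on which
`χ` does not vanish can be moved to any other character `ψ` by winding automorphisms. -/
theorem exists_eigenvector_of_character (χ ψ : B →ₐ[k] k) (t : B) (ht : ∀ b, b * t = χ b • t)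
    (h1 : χ t = 1) : ∃ z : B, (∀ b, b * z = ψ b • z) ∧ ψ z = 1 := by
  obtain ⟨z, hz⟩ := (windingMap_bijective ψ).2 (windingMap χ.toLinearMap t)
  have hψ : ∀ b, ψ b = counit (R := k) (windingMap ψ.toLinearMap b) :=
    fun b => (counit_windingMap ψ.toLinearMap b).symm
  have hχ : ∀ b, χ b = counit (R := k) (windingMap χ.toLinearMap b) :=
    fun b => (counit_windingMap χ.toLinearMap b).symm
  refine ⟨z, fun b => (windingMap_bijective ψ).1 ?_, by rw [hψ, hz, ← hχ, h1]⟩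
  obtain ⟨c, hc⟩ := (windingMap_bijective χ).2 (windingMap ψ.toLinearMap b)
  rw [windingMap_mul, map_smul, hz, ← hc, ← windingMap_mul, ht, map_smul, hψ, ← hc, ← hχ]

end Winding

/-! ### Idempotents and isomorphic left ideals -/

section Idempotents

variable {A : Type*} [Ring A]

theorem exists_eq_mul_mul_of_span_equiv {p p' : A} (hp' : IsIdempotentElem p')
    (h : Ideal.span {p} ≃ₗ[A] Ideal.span {p'}) : ∃ x y : A, p = x * p' * y := by
  have mp : p ∈ Ideal.span {p} := Ideal.subset_span rfl
  have mp' : p' ∈ Ideal.span {p'} := Ideal.subset_span rfl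
  obtain ⟨x, hx⟩ := Ideal.mem_span_singleton'.1 (h ⟨p, mp⟩).2
  refine ⟨x, h.symm ⟨p', mp'⟩, ?_⟩
  have h1 : h ⟨p, mp⟩ = (x * p') • ⟨p', mp'⟩ := by
    ext
    simp [← hx, mul_assoc, hp'.eq]
  have h2 := congrArg h.symm h1
  rw [LinearEquiv.symm_apply_apply, map_smul] at h2
  exact congrArg Subtype.val h2

theorem span_equiv_of_mul_eq {p p' u v : A} (hp : IsIdempotentElem p) (hp' : IsIdempotentElem p')
    (h : u * v = p) (h' : v * u = p') : Nonempty (Ideal.span {p} ≃ₗ[A] Ideal.span {p'}) := by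
  have key : ∀ {p p' u v : A}, IsIdempotentElem p → u * v = p → v * u = p' →
      ∀ x : Ideal.span {p}, x.1 * u ∈ Ideal.span {p'} ∧ x.1 * u * v = x.1 := by
    intro p p' u v hp h h' x
    obtain ⟨y, hy⟩ := Ideal.mem_span_singleton'.1 x.2
    have hx : x.1 * u * v = x.1 := by rw [mul_assoc, h, ← hy, mul_assoc, hp.eq]
    refine ⟨Ideal.mem_span_singleton'.2 ⟨x.1 * u, ?_⟩, hx⟩
    rw [← h', ← mul_assoc, hx]
  exact ⟨{ toFun := fun x => ⟨x.1 * u, (key hp h h' x).1⟩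
           invFun := fun x => ⟨x.1 * v, (key hp' h' h x).1⟩
           map_add' := fun x y => Subtype.ext (add_mul _ _ _)
           map_smul' := fun a x => Subtype.ext (mul_assoc _ _ _)
           left_inv := fun x => Subtype.ext (key hp h h' x).2
           right_inv := fun x => Subtype.ext (key hp' h' h x).2 }⟩

/-- A basic idempotent `e` is full (`A e A = A`), in the form in which it is used here: only `0`
is killed by all `e * a`. -/
theorem IsBasicIdempotent.eq_zero_of_forall_mul {e : A} (he : IsBasicIdempotent e) {R : Type*}
    [Ring R] (π : A →+* R) {m : R} (hm : ∀ a, π (e * a) * m = 0) : m = 0 := by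
  obtain ⟨n, ε, s, hε, -, hs, rfl⟩ := he
  have h1 : ∀ i, π (ε i) * m = 0 := by
    intro i
    obtain ⟨j, ⟨hj, ⟨h⟩⟩, -⟩ := hs i
    obtain ⟨x, y, hxy⟩ := exists_eq_mul_mul_of_span_equiv (hε.idem j) h
    have h2 : ε j * ∑ l ∈ s, ε l = ε j := by
      rw [Finset.mul_sum, Finset.sum_eq_single_of_mem j hj
        (fun l _ hl => hε.ortho hl.symm), (hε.idem j).eq]
    rw [hxy, ← h2]
    have := hm y
    rw [mul_assoc, mul_assoc, map_mul, map_mul, mul_assoc, mul_assoc, this, mul_zero, mul_zero]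
  have h2 : π (∑ i, ε i) * m = 0 := by
    rw [map_sum, Finset.sum_mul]
    exact Finset.sum_eq_zero fun i _ => h1 i
  rwa [hε.complete, map_one, one_mul] at h2

theorem IsBasicIdempotent.isIdempotentElem {e : A} (he : IsBasicIdempotent e) :
    IsIdempotentElem e := by
  obtain ⟨n, ε, s, hε, -, -, rfl⟩ := he
  exact hε.toOrthogonalIdempotents.isIdempotentElem_sum

/-- If `A f` is a simple projective left module with endomorphism ring `k`, then exactly one of
the primitive idempotents composing a basic idempotent `e` acts on it by a nonzero map; this
idempotent `t` then spans the left ideal `e A t` of `e A e`. -/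
theorem IsBasicIdempotent.exists_eigenvector {k : Type*} [Field k] [Algebra k A] {e : A}
    (he : IsBasicIdempotent e) {f : A} (hf0 : f ≠ 0) (hf : IsIdempotentElem f)
    (hcorner : ∀ a, ∃ c : k, f * a * f = c • f) (hsimple : ∀ a, a * f ≠ 0 → ∃ b, b * (a * f) = f) :
    ∃ t : A, t ≠ 0 ∧ IsIdempotentElem t ∧ e * t * e = t ∧ ∀ a, ∃ c : k, e * a * e * t = c • t := by
  have hfull : ∃ a, e * a * f ≠ 0 := by
    by_contra! h
    exact hf0 (he.eq_zero_of_forall_mul (RingHom.id A) h)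
  obtain ⟨n, ε, s, hε, hprim, hs, rfl⟩ := he
  -- Each `ε j` acting nontrivially on `A f` factors through `f`, hence is equivalent to `f`.
  have key : ∀ j a, ε j * a * f ≠ 0 → ∃ u v, u * v = ε j ∧ v * u = f ∧ u * f = u := by
    intro j a ha
    obtain ⟨b, hb⟩ := hsimple _ ha
    set y := ε j * a * f with hy
    have hyl : ε j * y = y := by rw [hy, ← mul_assoc, ← mul_assoc, (hε.idem j).eq]
    have hyf : y * f = y := by rw [hy, mul_assoc, hf.eq]
    refine ⟨y, f * b * ε j, ?_, ?_, hyf⟩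
    · have hg : IsIdempotentElem (y * (f * b * ε j)) := by
        have : y * (f * b * ε j) * (y * (f * b * ε j)) =
            y * f * (b * (ε j * y)) * (f * b * ε j) := by noncomm_ring
        rw [IsIdempotentElem, this, hyl, hb, hyf, ← mul_assoc, ← mul_assoc, ← mul_assoc, hyf,
          ← mul_assoc, hyf]
      have hl : ε j * (y * (f * b * ε j)) = y * (f * b * ε j) := by rw [← mul_assoc, hyl]
      have hr : y * (f * b * ε j) * ε j = y * (f * b * ε j) := by
        rw [mul_assoc, mul_assoc (f * b), (hε.idem j).eq]
      obtain h0 | h0 := (hprim j).2.2 (y * (f * b * ε j)) (ε j - y * (f * b * ε j)) hg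
        (by rw [IsIdempotentElem, sub_mul, mul_sub, mul_sub, (hε.idem j).eq, hl, hr, hg.eq,
              sub_self, sub_zero])
        (by rw [mul_sub, hr, hg.eq, sub_self]) (by rw [sub_mul, hl, hg.eq, sub_self])
        (by rw [add_sub_cancel])
      · exfalso
        have h1 : f * b * ε j * (y * (f * b * ε j)) * y = f := by
          have : f * b * ε j * (y * (f * b * ε j)) * y =
            f * (b * (ε j * y)) * f * (b * (ε j * y)) := by noncomm_ring
          rw [this, hyl, hb, hf.eq, hf.eq, hf.eq]
        rw [h0, mul_zero, zero_mul] at h1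
        exact hf0 h1.symm
      · exact (sub_eq_zero.1 h0).symm
    · rw [mul_assoc, hyl, mul_assoc, hb, hf.eq]
  obtain ⟨a, ha⟩ := hfull
  obtain ⟨j, hj, hja⟩ : ∃ j ∈ s, ε j * a * f ≠ 0 := by
    by_contra! h
    apply ha
    rw [Finset.sum_mul, Finset.sum_mul]
    exact Finset.sum_eq_zero h
  obtain ⟨u, v, huv, hvu, huf⟩ := key j a hja
  have hsum_l : (∑ l ∈ s, ε l) * ε j = ε j := by
    rw [Finset.sum_mul, Finset.sum_eq_single_of_mem j hj (fun l _ hl => hε.ortho hl),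
      (hε.idem j).eq]
  have hsum_r : ε j * ∑ l ∈ s, ε l = ε j := by
    rw [Finset.mul_sum, Finset.sum_eq_single_of_mem j hj (fun l _ hl => hε.ortho hl.symm),
      (hε.idem j).eq]
  refine ⟨ε j, (hprim j).1, hε.idem j, by rw [hsum_l, hsum_r], fun b => ?_⟩
  -- Another such `l` would give `A ε l ≃ A f ≃ A ε j`, but `s` meets each isomorphism class once.
  have hvan : ∀ l ∈ s, l ≠ j → ε l * b * ε j = 0 := by
    intro l hl hlj
    by_contra hne
    have hne' : ε l * (b * u) * f ≠ 0 := by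
      intro h0
      apply hne
      rw [← huv, ← huf]
      calc ε l * b * (u * f * v) = ε l * (b * u) * f * v := by noncomm_ring
        _ = 0 := by rw [h0, zero_mul]
    obtain ⟨u', v', huv', hvu', huf'⟩ := key l _ hne'
    have hiso := span_equiv_of_mul_eq (hε.idem l) (hε.idem j) (u := u' * v) (v := u * v')
      (by
        calc u' * v * (u * v') = u' * (v * u) * v' := by noncomm_ring
          _ = ε l := by rw [hvu, huf', huv'])
      (by
        calc u * v' * (u' * v) = u * (v' * u') * v := by noncomm_ring
          _ = ε j := by rw [hvu', huf, huv])
    obtain ⟨i, -, hi⟩ := hs l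
    exact hlj ((hi l ⟨hl, ⟨LinearEquiv.refl _ _⟩⟩).trans (hi j ⟨hj, hiso⟩).symm)
  obtain ⟨c, hc⟩ := hcorner (v * b * u)
  refine ⟨c, ?_⟩
  calc (∑ l ∈ s, ε l) * b * (∑ l ∈ s, ε l) * ε j = ∑ l ∈ s, ε l * b * ε j := by
        rw [mul_assoc _ _ (ε j), hsum_l, Finset.sum_mul, Finset.sum_mul]
    _ = ε j * b * ε j := Finset.sum_eq_single_of_mem j hj hvan
    _ = u * v * b * (u * v) := by rw [huv]
    _ = u * f * v * b * (u * f * v) := by rw [huf]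
    _ = u * (f * (v * b * u) * f) * v := by noncomm_ring
    _ = c • ε j := by rw [hc, mul_smul_comm, smul_mul_assoc, huf, huv]

end Idempotents

/-! ### Hopf structures on a basic algebra -/

/-- If the basic algebra `B` of `A` is a Hopf algebra and `A` has a simple projective module `A f`
with endomorphism ring `k`, then every character `α` of `A` is a projective module, namely the left
ideal `A y = k y` of an idempotent `y`. Indeed `A f` gives a projective character of `B`, a winding
automorphism moves it to the restriction of `α`, and fullness of `e` transfers it back to `A`. -/
theorem IsBasicAlgebraOf.exists_eigenvector {k A B : Type*} [Field k] [Ring A] [Algebra k A]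
    [Ring B] [HopfAlgebra k B] (hB : IsBasicAlgebraOf k A B) {f : A} (hf0 : f ≠ 0)
    (hf : IsIdempotentElem f) (hcorner : ∀ a, ∃ c : k, f * a * f = c • f)
    (hsimple : ∀ a, a * f ≠ 0 → ∃ b, b * (a * f) = f) (α : A →ₐ[k] k) :
    ∃ y : A, α y = 1 ∧ ∀ a, a * y = α a • y := by
  obtain ⟨e, φ, he, hinj, hrange⟩ := hB
  have hee := he.isIdempotentElem
  have hmem : ∀ b, ∃ a, e * a * e = φ b := fun b => by
    have : φ b ∈ Set.range φ := ⟨b, rfl⟩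
    rwa [hrange] at this
  have hsurj : ∀ a, ∃ b, φ b = e * a * e := fun a => by
    have : e * a * e ∈ Set.range φ := by rw [hrange]; exact ⟨a, rfl⟩
    exact this
  have hφ1 : φ 1 = e := by
    obtain ⟨a, ha⟩ := hmem 1
    obtain ⟨b, hb⟩ := hsurj 1
    rw [mul_one, hee.eq] at hb
    calc φ 1 = φ 1 * e := by rw [← ha, mul_assoc (e * a), hee.eq]
      _ = e := by rw [← hb, ← map_mul, one_mul]
  have hαe : α e = 1 := by
    have h0 : α e ≠ 0 := by
      intro h0
      refine one_ne_zero (he.eq_zero_of_forall_mul (α : A →+* k) (m := 1) fun a => ?_)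
      simp [h0]
    have h1 : α e * α e = α e := by rw [← map_mul, hee.eq]
    exact mul_left_cancel₀ h0 (by rw [h1, mul_one])
  obtain ⟨t, ht0, htt, hte, ht⟩ := he.exists_eigenvector hf0 hf hcorner hsimple
  have ht' : ∀ b, ∃ c : k, φ b * t = c • t := fun b => by
    obtain ⟨a, ha⟩ := hmem b
    rw [← ha]
    exact ht a
  choose χ hχ using ht'
  have huniq : ∀ c d : k, c • t = d • t → c = d := fun c d h => smul_left_injective k ht0 h
  let χ' : B →ₐ[k] k := AlgHom.ofLinearMap
    { toFun := χ
      map_add' := fun a b => huniq _ _ (by rw [← hχ, map_add, add_mul, hχ, hχ, add_smul])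
      map_smul' := fun c b => huniq _ _ (by
        rw [← hχ, map_smul, smul_mul_assoc, hχ, smul_smul, RingHom.id_apply, smul_eq_mul]) }
    (huniq _ _ (by
      change χ 1 • t = _
      rw [← hχ, hφ1, one_smul, ← hte, ← mul_assoc, ← mul_assoc, hee.eq]))
    (fun a b => huniq _ _ (by
      change χ (a * b) • t = (χ a * χ b) • t
      rw [← hχ, map_mul, mul_assoc, hχ, mul_smul_comm, hχ, smul_smul, mul_comm]))
  let ψ : B →ₐ[k] k := AlgHom.ofLinearMap (α.toLinearMap ∘ₗ (φ : B →ₗ[k] A))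
    (by change α (φ 1) = 1; rw [hφ1, hαe])
    (fun a b => by change α (φ (a * b)) = α (φ a) * α (φ b); rw [map_mul, map_mul])
  obtain ⟨t', ht'⟩ := hsurj t
  rw [hte] at ht'
  obtain ⟨z, hz, hz1⟩ := exists_eigenvector_of_character χ' ψ t'
    (fun b => hinj (by rw [map_mul, map_smul, ht']; exact hχ b))
    (huniq _ _ (by
      change χ t' • t = _
      rw [← hχ, ht', htt.eq, one_smul]))
  refine ⟨φ z, hz1, fun a => sub_eq_zero.1 (he.eq_zero_of_forall_mul (RingHom.id A) fun b => ?_)⟩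
  have hez : e * φ z = φ z := by rw [← hφ1, ← map_mul, one_mul]
  -- `e * c` acts on `φ z` as `e * c * e` does, that is, by the scalar `α c`.
  have hact : ∀ c, e * c * φ z = α c • φ z := fun c => by
    obtain ⟨b, hb⟩ := hsurj c
    have h1 := congrArg φ (hz b)
    rw [map_mul, map_smul, hb, mul_assoc, hez] at h1
    rw [h1]
    congr 1
    change α (φ b) = α c
    rw [hb, map_mul, map_mul, hαe, one_mul, mul_one]
  change e * b * (a * φ z - α a • φ z) = 0
  rw [mul_sub, mul_smul_comm, ← mul_assoc, mul_assoc e b a, hact, hact, smul_smul, map_mul,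
    mul_comm, sub_self]

/-! ### Generators and representations of the truncated quantum algebra -/

namespace QSl2

section Presentation

variable {k : Type*} [Field k] {q : k} {e N : ℕ}

/-- The image of a generator in the truncated algebra. -/
noncomputable def X (q : k) (e N : ℕ) (g : QSl2Gen) : TruncatedQSl2 q e N :=
  RingQuot.mkAlgHom k (Rel q e N) (gen k g)

theorem K_mul_Kinv : X q e N .K * X q e N .Kinv = 1 := by
  simpa [X] using RingQuot.mkAlgHom_rel k (Rel.K_mul_Kinv (q := q) (e := e) (N := N))

theorem Kinv_mul_K : X q e N .Kinv * X q e N .K = 1 := by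
  simpa [X] using RingQuot.mkAlgHom_rel k (Rel.Kinv_mul_K (q := q) (e := e) (N := N))

theorem K_mul_E : X q e N .K * X q e N .E = q ^ 2 • (X q e N .E * X q e N .K) := by
  have h : X q e N .K * X q e N .E * X q e N .Kinv = q ^ 2 • X q e N .E := by
    simpa [X] using RingQuot.mkAlgHom_rel k (Rel.K_E (q := q) (e := e) (N := N))
  rw [← smul_mul_assoc, ← h, mul_assoc _ _ (X q e N .K), Kinv_mul_K, mul_one]

theorem K_mul_F : X q e N .K * X q e N .F = (q ^ 2)⁻¹ • (X q e N .F * X q e N .K) := by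
  have h : X q e N .K * X q e N .F * X q e N .Kinv = (q ^ 2)⁻¹ • X q e N .F := by
    simpa [X] using RingQuot.mkAlgHom_rel k (Rel.K_F (q := q) (e := e) (N := N))
  rw [← smul_mul_assoc, ← h, mul_assoc _ _ (X q e N .K), Kinv_mul_K, mul_one]

theorem E_mul_F : X q e N .E * X q e N .F = X q e N .F * X q e N .E +
    (q - q⁻¹)⁻¹ • (X q e N .K - X q e N .Kinv) := by
  rw [← sub_eq_iff_eq_add']
  simpa [X] using RingQuot.mkAlgHom_rel k (Rel.E_F (q := q) (e := e) (N := N))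

theorem E_pow : X q e N .E ^ e = 0 := by
  simpa [X] using RingQuot.mkAlgHom_rel k (Rel.E_pow (q := q) (e := e) (N := N))

theorem F_pow : X q e N .F ^ e = 0 := by
  simpa [X] using RingQuot.mkAlgHom_rel k (Rel.F_pow (q := q) (e := e) (N := N))

theorem K_pow : X q e N .K ^ N = 1 := by
  simpa [X] using RingQuot.mkAlgHom_rel k (Rel.K_pow (q := q) (e := e) (N := N))

theorem exists_lift {R : Type*} [Ring R] [Algebra k R] (x : QSl2Gen → R)
    (h1 : x .K * x .Kinv = 1) (h2 : x .Kinv * x .K = 1)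
    (h3 : x .K * x .E = q ^ 2 • (x .E * x .K)) (h4 : x .K * x .F = (q ^ 2)⁻¹ • (x .F * x .K))
    (h5 : x .E * x .F - x .F * x .E = (q - q⁻¹)⁻¹ • (x .K - x .Kinv))
    (h6 : x .E ^ e = 0) (h7 : x .F ^ e = 0) (h8 : x .K ^ N = 1) :
    ∃ ρ : TruncatedQSl2 q e N →ₐ[k] R, ∀ g, ρ (X q e N g) = x g := by
  refine ⟨RingQuot.liftAlgHom k ⟨FreeAlgebra.lift k x, ?_⟩, fun g => ?_⟩
  · intro a b hab
    cases hab with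
    | K_mul_Kinv => simpa using h1
    | Kinv_mul_K => simpa using h2
    | K_E =>
      simp only [map_mul, FreeAlgebra.lift_ι_apply, map_smul, h3, smul_mul_assoc]
      rw [mul_assoc, h1, mul_one]
    | K_F =>
      simp only [map_mul, FreeAlgebra.lift_ι_apply, map_smul, h4, smul_mul_assoc]
      rw [mul_assoc, h1, mul_one]
    | E_F => simpa using h5
    | E_pow => simpa using h6
    | F_pow => simpa using h7
    | K_pow => simpa using h8
  · simp [X]

/-- A linear map between two modules is linear over the truncated algebra as soon as it commutes
with the generators. -/
theorem intertwines {V W : Type*} [AddCommGroup V] [Module k V] [AddCommGroup W] [Module k W]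
    (ρ : TruncatedQSl2 q e N →ₐ[k] Module.End k V) (σ : TruncatedQSl2 q e N →ₐ[k] Module.End k W)
    (θ : V →ₗ[k] W) (h : ∀ g v, θ (ρ (X q e N g) v) = σ (X q e N g) (θ v))
    (a : TruncatedQSl2 q e N) (v : V) : θ (ρ a v) = σ a (θ v) := by
  obtain ⟨a, rfl⟩ := RingQuot.mkAlgHom_surjective k (Rel q e N) a
  induction a using FreeAlgebra.induction generalizing v with
  | grade0 r => simp [AlgHom.commutes, Module.algebraMap_end_apply]
  | grade1 g => exact h g v
  | mul a b ha hb => simp only [map_mul, Module.End.mul_apply, ha, hb]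
  | add a b ha hb => simp only [map_add, LinearMap.add_apply, ha, hb]

/-- The trivial character. -/
theorem exists_character (he : e ≠ 0) : ∃ α : TruncatedQSl2 q e N →ₐ[k] k,
    α (X q e N .E) = 0 ∧ α (X q e N .F) = 0 ∧ α (X q e N .K) = 1 ∧ α (X q e N .Kinv) = 1 := by
  obtain ⟨α, hα⟩ := exists_lift (q := q) (e := e) (N := N) (R := k)
    (fun | .E => 0 | .F => 0 | .K => 1 | .Kinv => 1)
    (by simp) (by simp) (by simp) (by simp) (by simp) (by simp [he]) (by simp [he]) (by simp)
  exact ⟨α, hα _, hα _, hα _, hα _⟩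

end Presentation

/-! ### Highest weight modules -/

section HighestWeight

variable {k : Type*} [Field k]

/-- The scalar by which `E F - F E` acts on a vector of weight `lam * q⁻²ⁿ`. -/
noncomputable def commScalar (q lam : k) (n : ℕ) : k :=
  (q - q⁻¹)⁻¹ * (lam * ((q ^ 2)⁻¹) ^ n - lam⁻¹ * (q ^ 2) ^ n)

/-- The scalar `[n] (lam q^(1-n) - lam⁻¹ q^(n-1)) / (q - q⁻¹)` in `E F^n v = raise n • F^(n-1) v`
for a highest weight vector `v` of weight `lam`. -/
noncomputable def raise (q lam : k) (n : ℕ) : k :=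
  (q - q⁻¹)⁻¹ ^ 2 * (q ^ n - q⁻¹ ^ n) * (lam * q * q⁻¹ ^ n - lam⁻¹ * q⁻¹ * q ^ n)

theorem raise_zero (q lam : k) : raise q lam 0 = 0 := by simp [raise]

theorem raise_succ {q : k} (hq : q ≠ 0) (hq2 : q ^ 2 ≠ 1) (lam : k) (n : ℕ) :
    raise q lam (n + 1) = raise q lam n + commScalar q lam n := by
  have h1 : q - q⁻¹ ≠ 0 := by
    intro h
    apply hq2
    field_simp at h
    linear_combination h
  have hqn : q ^ n * q⁻¹ ^ n = 1 := by rw [← mul_pow, mul_inv_cancel₀ hq, one_pow]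
  have hqq : q * q⁻¹ = 1 := mul_inv_cancel₀ hq
  have hc : (q - q⁻¹)⁻¹ * (q - q⁻¹) = 1 := inv_mul_cancel₀ h1
  have hr : (q ^ 2)⁻¹ ^ n = (q⁻¹ ^ n) ^ 2 := by rw [← inv_pow, ← pow_mul, ← pow_mul, mul_comm]
  have hr' : (q ^ 2) ^ n = (q ^ n) ^ 2 := by rw [← pow_mul, ← pow_mul, mul_comm]
  rw [raise, raise, commScalar, hr, hr', pow_succ q n, pow_succ q⁻¹ n]
  generalize (q - q⁻¹)⁻¹ = c at *
  generalize q ^ n = x at *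
  generalize q⁻¹ ^ n = y at *
  generalize q⁻¹ = r at *
  generalize lam⁻¹ = m at *
  have e1 : c ^ 2 * (x * q - y * r) * (lam * q * (y * r) - m * r * (x * q)) -
      c ^ 2 * (x - y) * (lam * q * y - m * r * x) =
      c * (c * (q - r)) * (lam * y ^ 2 - m * x ^ 2) := by
    linear_combination c ^ 2 * ((x * q - y * r) * (lam * y - m * x) ) * hqq
  rw [hc, mul_one] at e1
  linear_combination e1

theorem raise_eq_zero {q : k} {p : ℕ} (hp : (q ^ 2) ^ p = 1) (lam : k) :
    raise q lam p = 0 := by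
  have h : q ^ p = q⁻¹ ^ p := by
    rw [inv_pow]
    exact eq_inv_of_mul_eq_one_left (by rw [← mul_pow, ← sq, hp])
  rw [raise, h, sub_self, mul_zero, zero_mul]

theorem raise_one_one (q : k) (hq : q ≠ 0) : raise q 1 1 = 0 := by
  simp [raise, hq]

/-- The standard basis vectors of `kᵖ`, continued by zero. -/
noncomputable def vec (k : Type*) [Field k] (p n : ℕ) : Fin p → k :=
  if h : n < p then Pi.single ⟨n, h⟩ 1 else 0

theorem vec_of_le {p n : ℕ} (h : p ≤ n) : vec k p n = 0 := dif_neg (by omega)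

theorem vec_apply {p n : ℕ} (i : Fin p) : vec k p n i = if n = i then 1 else 0 := by
  unfold vec
  split_ifs with h1 h2 h2
  · subst h2; simp
  · rw [Pi.single_apply, if_neg]; rintro rfl; exact h2 rfl
  · omega
  · rfl

/-- The linear map sending the `n`-th standard basis vector of `kᵖ` to `x n`. -/
noncomputable def ofVec {W : Type*} [AddCommGroup W] [Module k W] (p : ℕ) (x : ℕ → W) :
    (Fin p → k) →ₗ[k] W :=
  (Pi.basisFun k (Fin p)).constr k fun i => x i

variable {W : Type*} [AddCommGroup W] [Module k W]

theorem basisFun_eq_vec {p : ℕ} (i : Fin p) : Pi.basisFun k (Fin p) i = vec k p i := by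
  simp [vec]

theorem ofVec_vec {p : ℕ} {x : ℕ → W} (hx : ∀ n, p ≤ n → x n = 0) (n : ℕ) :
    ofVec p x (vec k p n) = x n := by
  by_cases h : n < p
  · rw [ofVec, ← basisFun_eq_vec ⟨n, h⟩, Module.Basis.constr_basis]
  · rw [vec_of_le (by omega), map_zero, hx n (by omega)]

theorem ext_vec {p : ℕ} {f g : (Fin p → k) →ₗ[k] W} (h : ∀ n, f (vec k p n) = g (vec k p n)) :
    f = g :=
  (Pi.basisFun k (Fin p)).ext fun i => by rw [basisFun_eq_vec, h]

theorem eq_sum_vec {p : ℕ} (w : Fin p → k) : w = ∑ i, w i • vec k p i := by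
  simp_rw [← basisFun_eq_vec]
  exact ((Pi.basisFun k (Fin p)).sum_repr w).symm

/-- The highest weight module with basis `v₀, …, v_{p-1}`, highest weight `lam` and
`F vₙ = vₙ₊₁`. -/
theorem exists_highestWeightModule {q lam : k} {p N : ℕ} (hq : q ≠ 0) (hq2 : q ^ 2 ≠ 1)
    (hp : (q ^ 2) ^ p = 1) (hN : (q ^ 2) ^ N = 1) (hlam : lam ≠ 0) (hlamN : lam ^ N = 1) :
    ∃ ρ : TruncatedQSl2 q p N →ₐ[k] Module.End k (Fin p → k), ∀ n,
      ρ (X q p N .E) (vec k p n) = raise q lam n • vec k p (n - 1) ∧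
      ρ (X q p N .F) (vec k p n) = vec k p (n + 1) ∧
      ρ (X q p N .K) (vec k p n) = (lam * (q ^ 2)⁻¹ ^ n) • vec k p n ∧
      ρ (X q p N .Kinv) (vec k p n) = (lam⁻¹ * (q ^ 2) ^ n) • vec k p n := by
  let opE : Module.End k (Fin p → k) := ofVec p fun n => raise q lam n • vec k p (n - 1)
  let opF : Module.End k (Fin p → k) := ofVec p fun n => vec k p (n + 1)
  let opK : Module.End k (Fin p → k) := ofVec p fun n => (lam * (q ^ 2)⁻¹ ^ n) • vec k p n
  let opL : Module.End k (Fin p → k) := ofVec p fun n => (lam⁻¹ * (q ^ 2) ^ n) • vec k p n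
  have hE : ∀ n, opE (vec k p n) = raise q lam n • vec k p (n - 1) := ofVec_vec fun n hn => by
    obtain rfl | h := hn.eq_or_lt
    · rw [raise_eq_zero hp, zero_smul]
    · rw [vec_of_le (by omega), smul_zero]
  have hF : ∀ n, opF (vec k p n) = vec k p (n + 1) := ofVec_vec fun n hn => vec_of_le (by omega)
  have hK : ∀ n, opK (vec k p n) = (lam * (q ^ 2)⁻¹ ^ n) • vec k p n := ofVec_vec fun n hn => by
    rw [vec_of_le hn, smul_zero]
  have hL : ∀ n, opL (vec k p n) = (lam⁻¹ * (q ^ 2) ^ n) • vec k p n := ofVec_vec fun n hn => by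
    rw [vec_of_le hn, smul_zero]
  have hqq : q ^ 2 ≠ 0 := pow_ne_zero 2 hq
  have hinv : ∀ n, (lam * (q ^ 2)⁻¹ ^ n) * (lam⁻¹ * (q ^ 2) ^ n) = 1 := fun n => by
    rw [mul_mul_mul_comm, mul_inv_cancel₀ hlam, ← mul_pow, inv_mul_cancel₀ hqq, one_pow, one_mul]
  have hKE : opK * opE = q ^ 2 • (opE * opK) := ext_vec fun n => by
    simp only [Module.End.mul_apply, LinearMap.smul_apply, hE, hK, map_smul, smul_smul]
    cases n with
    | zero => simp [raise_zero]
    | succ n =>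
      rw [Nat.add_sub_cancel]
      congr 1
      rw [pow_succ]
      linear_combination (-raise q lam (n + 1) * lam * (q ^ 2)⁻¹ ^ n) * mul_inv_cancel₀ hqq
  have hKF : opK * opF = (q ^ 2)⁻¹ • (opF * opK) := ext_vec fun n => by
    simp only [Module.End.mul_apply, LinearMap.smul_apply, hF, hK, map_smul, smul_smul]
    congr 1
    ring
  have hEF : opE * opF - opF * opE = (q - q⁻¹)⁻¹ • (opK - opL) := ext_vec fun n => by
    simp only [Module.End.mul_apply, LinearMap.smul_apply, LinearMap.sub_apply, hF, hE, hK, hL,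
      map_smul, ← sub_smul, smul_smul, Nat.add_sub_cancel]
    have h : raise q lam n • vec k p (n - 1 + 1) = raise q lam n • vec k p n := by
      cases n with
      | zero => simp [raise_zero]
      | succ n => rw [Nat.add_sub_cancel]
    rw [h, ← sub_smul, raise_succ hq hq2, add_sub_cancel_left, commScalar]
  have hEpow : ∀ m n, n < m → (opE ^ m) (vec k p n) = 0 := by
    intro m
    induction m with
    | zero => intro n hn; omega
    | succ m ih =>
      intro n hn
      rw [pow_succ, Module.End.mul_apply, hE, map_smul]
      obtain rfl | h0 := Nat.eq_zero_or_pos n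
      · rw [raise_zero, zero_smul]
      · rw [ih _ (by omega), smul_zero]
  have hFpow : ∀ m n, (opF ^ m) (vec k p n) = vec k p (n + m) := by
    intro m
    induction m with
    | zero => intro n; rfl
    | succ m ih => intro n; rw [pow_succ, Module.End.mul_apply, hF, ih, add_right_comm, add_assoc]
  have hKpow : ∀ m n, (opK ^ m) (vec k p n) = (lam * (q ^ 2)⁻¹ ^ n) ^ m • vec k p n := by
    intro m n
    induction m with
    | zero => simp
    | succ m ih => rw [pow_succ', Module.End.mul_apply, ih, map_smul, hK, smul_smul, ← pow_succ]
  obtain ⟨ρ, hρ⟩ := exists_lift (q := q) (e := p) (N := N) (R := Module.End k (Fin p → k))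
    (fun | .E => opE | .F => opF | .K => opK | .Kinv => opL)
    (ext_vec fun n => by
      simp only [Module.End.mul_apply, hL, hK, map_smul, smul_smul]
      rw [mul_comm, hinv, one_smul, Module.End.one_apply])
    (ext_vec fun n => by
      simp only [Module.End.mul_apply, hL, hK, map_smul, smul_smul]
      rw [hinv, one_smul, Module.End.one_apply])
    hKE hKF hEF
    (ext_vec fun n => by
      by_cases h : n < p
      · exact hEpow p n h
      · rw [vec_of_le (by omega), map_zero, map_zero])
    (ext_vec fun n => by
      change (opF ^ p) _ = _
      rw [hFpow, vec_of_le (by omega), LinearMap.zero_apply])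
    (ext_vec fun n => by
      change (opK ^ N) _ = _
      rw [hKpow, mul_pow, hlamN, pow_right_comm, inv_pow, hN, inv_one, one_pow, one_mul, one_smul,
        Module.End.one_apply])
  exact ⟨ρ, fun n => ⟨by rw [hρ]; exact hE n, by rw [hρ]; exact hF n, by rw [hρ]; exact hK n,
    by rw [hρ]; exact hL n⟩⟩

end HighestWeight

/-! ### The Steinberg module -/

section Steinberg

variable {k : Type*} [Field k] {q : k} {p N : ℕ}

/-- The highest weight module maps to the left ideal generated by any highest weight vector of the
same weight. -/
theorem highestWeight_intertwines {lam : k} (hq : q ≠ 0) (hq2 : q ^ 2 ≠ 1)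
    (hlam : lam ≠ 0)
    {ρ : TruncatedQSl2 q p N →ₐ[k] Module.End k (Fin p → k)}
    (hρ : ∀ n, ρ (X q p N .E) (vec k p n) = raise q lam n • vec k p (n - 1) ∧
      ρ (X q p N .F) (vec k p n) = vec k p (n + 1) ∧
      ρ (X q p N .K) (vec k p n) = (lam * (q ^ 2)⁻¹ ^ n) • vec k p n ∧
      ρ (X q p N .Kinv) (vec k p n) = (lam⁻¹ * (q ^ 2) ^ n) • vec k p n)
    {u : TruncatedQSl2 q p N} (hE : X q p N .E * u = 0) (hK : X q p N .K * u = lam • u) :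
    ∃ θ : (Fin p → k) →ₗ[k] TruncatedQSl2 q p N,
      (∀ n, θ (vec k p n) = X q p N .F ^ n * u) ∧ ∀ a v, θ (ρ a v) = a * θ v := by
  have hθ : ∀ n, ofVec p (fun n => X q p N .F ^ n * u) (vec k p n) = X q p N .F ^ n * u :=
    ofVec_vec fun n hn => by rw [pow_eq_zero_of_le hn F_pow, zero_mul]
  have hqq : q ^ 2 ≠ 0 := pow_ne_zero 2 hq
  have hKF : ∀ n, X q p N .K * (X q p N .F ^ n * u) =
      (lam * (q ^ 2)⁻¹ ^ n) • (X q p N .F ^ n * u) := by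
    intro n
    induction n with
    | zero => simpa using hK
    | succ n ih =>
      rw [pow_succ', mul_assoc, ← mul_assoc, K_mul_F, smul_mul_assoc, mul_assoc, ih,
        mul_smul_comm, smul_smul]
      congr 1
      ring
  have hLF : ∀ n, X q p N .Kinv * (X q p N .F ^ n * u) =
      (lam⁻¹ * (q ^ 2) ^ n) • (X q p N .F ^ n * u) := by
    intro n
    have h := congrArg (fun x => (lam⁻¹ * (q ^ 2) ^ n) • (X q p N .Kinv * x)) (hKF n)
    rw [← mul_assoc (X q p N .Kinv), Kinv_mul_K, one_mul, mul_smul_comm, smul_smul,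
      mul_mul_mul_comm, inv_mul_cancel₀ hlam, ← mul_pow, mul_inv_cancel₀ hqq, one_pow, one_mul, one_smul] at h
    exact h.symm
  have hEF : ∀ n, X q p N .E * (X q p N .F ^ n * u) =
      raise q lam n • (X q p N .F ^ (n - 1) * u) := by
    intro n
    induction n with
    | zero => simpa [raise_zero] using hE
    | succ n ih =>
      have h : X q p N .F * (raise q lam n • (X q p N .F ^ (n - 1) * u)) =
          raise q lam n • (X q p N .F ^ n * u) := by
        cases n with
        | zero => simp [raise_zero]
        | succ n => rw [Nat.add_sub_cancel, mul_smul_comm, pow_succ', mul_assoc]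
      rw [pow_succ', mul_assoc, ← mul_assoc, E_mul_F, add_mul, mul_assoc, ih, h, smul_mul_assoc,
        sub_mul, hKF, hLF, Nat.add_sub_cancel, raise_succ hq hq2, commScalar]
      module
  refine ⟨ofVec p fun n => X q p N .F ^ n * u, hθ, ?_⟩
  refine intertwines ρ (Algebra.lmul k _) _ fun g v => LinearMap.congr_fun
    (f := ofVec p (fun n => X q p N .F ^ n * u) ∘ₗ ρ (X q p N g))
    (g := Algebra.lmul k _ (X q p N g) ∘ₗ ofVec p fun n => X q p N .F ^ n * u)
    (ext_vec fun n => ?_) v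
  obtain ⟨h1, h2, h3, h4⟩ := hρ n
  rw [LinearMap.comp_apply, LinearMap.comp_apply, hθ]
  change _ = X q p N g * _
  cases g with
  | E => rw [h1, map_smul, hθ, hEF]
  | F => rw [h2, hθ, pow_succ', mul_assoc]
  | K => rw [h3, map_smul, hθ, hKF]
  | Kinv => rw [h4, map_smul, hθ, hLF]

theorem raise_ne_zero (hq : q ≠ 0) (hp : IsPrimitiveRoot (q ^ 2) p) {n : ℕ} (h0 : n ≠ 0)
    (hn : n < p) : raise q q⁻¹ n ≠ 0 := by
  have key : ∀ m, m ≠ 0 → m < p → q ^ m - q⁻¹ ^ m ≠ 0 := by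
    intro m hm hmp h
    apply hp.pow_ne_one_of_pos_of_lt hm hmp
    rw [← pow_mul, mul_comm, pow_mul, sq]
    nth_rewrite 2 [sub_eq_zero.1 h]
    rw [← mul_pow, mul_inv_cancel₀ hq, one_pow]
  have h1 := key n h0 hn
  have h2 : q - q⁻¹ ≠ 0 := by simpa using key 1 one_ne_zero (by omega)
  rw [raise, inv_mul_cancel₀ hq, inv_inv, mul_inv_cancel₀ hq, one_mul, one_mul]
  refine mul_ne_zero (mul_ne_zero (pow_ne_zero _ (inv_ne_zero h2)) h1) ?_
  rw [← neg_sub]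
  exact neg_ne_zero.2 h1

/-- The element `E^(p-1) P`, with `P` the projection to the `K`-eigenspace of eigenvalue `q`: a
highest weight vector of weight `q⁻¹` for left multiplication. -/
noncomputable def steinbergVector (q : k) (p N : ℕ) : TruncatedQSl2 q p N :=
  X q p N .E ^ (p - 1) * ((N : k)⁻¹ • ∑ i ∈ Finset.range N, (q⁻¹ • X q p N .K) ^ i)

theorem E_mul_steinbergVector (hp : p ≠ 0) : X q p N .E * steinbergVector q p N = 0 := by
  rw [steinbergVector, ← mul_assoc, ← pow_succ', Nat.sub_add_cancel (by omega), E_pow, zero_mul]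

theorem K_mul_steinbergVector (hq : q ≠ 0) (hp0 : p ≠ 0) (hp : (q ^ 2) ^ p = 1) (hN : q ^ N = 1) :
    X q p N .K * steinbergVector q p N = q⁻¹ • steinbergVector q p N := by
  have hKE : ∀ n, X q p N .K * X q p N .E ^ n = (q ^ 2) ^ n • (X q p N .E ^ n * X q p N .K) := by
    intro n
    induction n with
    | zero => simp
    | succ n ih =>
      rw [pow_succ, ← mul_assoc, ih, smul_mul_assoc, mul_assoc, K_mul_E, mul_smul_comm, smul_smul,
        ← pow_succ, mul_assoc]
  have hsum : X q p N .K * ∑ i ∈ Finset.range N, (q⁻¹ • X q p N .K) ^ i =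
      q • ∑ i ∈ Finset.range N, (q⁻¹ • X q p N .K) ^ i := by
    have h := mul_geom_sum (q⁻¹ • X q p N .K) N
    rw [smul_pow, inv_pow, hN, K_pow, inv_one, one_smul, sub_self, sub_mul, one_mul, sub_eq_zero,
      smul_mul_assoc] at h
    conv_rhs => rw [← h]
    rw [smul_smul, mul_inv_cancel₀ hq, one_smul]
  rw [steinbergVector, ← mul_assoc, hKE, smul_mul_assoc, mul_assoc, mul_smul_comm, hsum,
    mul_smul_comm, mul_smul_comm, mul_smul_comm, smul_smul, smul_smul, smul_smul]
  congr 1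
  obtain ⟨m, rfl⟩ := Nat.exists_eq_succ_of_ne_zero hp0
  have h2 : (q ^ 2) ^ m * q = q⁻¹ := by
    rw [eq_comm, inv_eq_iff_eq_inv, eq_comm]
    apply inv_eq_of_mul_eq_one_left
    rw [← hp, Nat.succ_eq_add_one]
    ring
  rw [Nat.succ_sub_one, ← h2]
  ring

/-- The Steinberg module is the left ideal generated by a primitive idempotent. -/
theorem exists_steinberg_idempotent (hq : q ≠ 0) (hp2 : 2 ≤ p) (hp : IsPrimitiveRoot (q ^ 2) p)
    (hN : q ^ N = 1) (hN0 : (N : k) ≠ 0) :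
    ∃ f : TruncatedQSl2 q p N, f ≠ 0 ∧ IsIdempotentElem f ∧ (∀ a, ∃ c : k, f * a * f = c • f) ∧
      ∀ a, a * f ≠ 0 → ∃ b, b * (a * f) = f := by
  have hq2 : q ^ 2 ≠ 1 := hp.ne_one (by omega)
  obtain ⟨ρ, hρ⟩ := exists_highestWeightModule (N := N) hq hq2 hp.pow_eq_one
    (by rw [pow_right_comm, hN, one_pow]) (inv_ne_zero hq) (by rw [inv_pow, hN, inv_one])
  set u := steinbergVector q p N with hu
  obtain ⟨θ, hθv, hθ⟩ := highestWeight_intertwines hq hq2 (inv_ne_zero hq) hρ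
    (E_mul_steinbergVector (by omega)) (K_mul_steinbergVector hq (by omega) hp.pow_eq_one hN)
  rw [← hu] at hθv
  have hF : ∀ m n, ρ (X q p N .F ^ m) (vec k p n) = vec k p (n + m) := by
    intro m
    induction m with
    | zero => intro n; rw [pow_zero, map_one]; rfl
    | succ m ih =>
      intro n
      rw [pow_succ, map_mul, Module.End.mul_apply, (hρ n).2.1, ih, add_right_comm, add_assoc]
  have hEm : ∀ m, m < p → ∃ c : k, c ≠ 0 ∧ ρ (X q p N .E ^ m) (vec k p m) = c • vec k p 0 := by
    intro m
    induction m with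
    | zero => exact fun _ => ⟨1, one_ne_zero, by simp⟩
    | succ m ih =>
      intro hm
      obtain ⟨c, hc, h⟩ := ih (by omega)
      refine ⟨raise q q⁻¹ (m + 1) * c, mul_ne_zero (raise_ne_zero hq hp (by omega) hm) hc, ?_⟩
      rw [pow_succ, map_mul, Module.End.mul_apply, (hρ _).1, map_smul, Nat.add_sub_cancel, h,
        smul_smul]
  obtain ⟨c, hc0, hc⟩ := hEm (p - 1) (by omega)
  have hP : ∀ n, n < p → ρ u (vec k p n) = if n = p - 1 then c • vec k p 0 else 0 := by
    intro n hn
    -- `q⁻¹ K` acts on the `n`-th basis vector by `q⁻²⁽ⁿ⁺¹⁾`, a root of unity of order dividing `N`.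
    have hpow : ∀ i, ρ ((q⁻¹ • X q p N .K) ^ i) (vec k p n) =
        (((q ^ 2)⁻¹ ^ (n + 1)) ^ i) • vec k p n := by
      intro i
      induction i with
      | zero => simp
      | succ i ih =>
        rw [pow_succ, map_mul, Module.End.mul_apply, map_smul, LinearMap.smul_apply,
          (hρ n).2.2.1, smul_smul, map_smul, ih, smul_smul]
        congr 1
        rw [pow_succ _ i, mul_comm, pow_succ _ n, ← inv_pow]
        ring
    have hsum : ρ u (vec k p n) = ((N : k)⁻¹ * ∑ i ∈ Finset.range N, ((q ^ 2)⁻¹ ^ (n + 1)) ^ i) •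
        ρ (X q p N .E ^ (p - 1)) (vec k p n) := by
      rw [hu, steinbergVector, map_mul, Module.End.mul_apply, map_smul, LinearMap.smul_apply,
        map_sum, LinearMap.sum_apply, Finset.sum_congr rfl fun i _ => hpow i, ← Finset.sum_smul,
        smul_smul, map_smul]
    rw [hsum]
    split_ifs with h
    · have h1 : (q ^ 2)⁻¹ ^ (n + 1) = 1 := by
        rw [h, Nat.sub_add_cancel (by omega), inv_pow, hp.pow_eq_one, inv_one]
      rw [h1, h, hc]
      simp [hN0]
    · have h1 : (q ^ 2)⁻¹ ^ (n + 1) - 1 ≠ 0 := by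
        rw [inv_pow, sub_ne_zero]
        intro h1
        exact hp.pow_ne_one_of_pos_of_lt (by omega) (by omega) (inv_eq_one.1 h1)
      have h2 := mul_geom_sum ((q ^ 2)⁻¹ ^ (n + 1)) N
      have h3 : ((q ^ 2)⁻¹ ^ (n + 1)) ^ N = 1 := by
        rw [pow_right_comm, inv_pow, pow_right_comm, hN, one_pow, inv_one, one_pow]
      rw [h3, sub_self] at h2
      rw [(mul_eq_zero.1 h2).resolve_left h1, mul_zero, zero_smul]
  let last : Fin p := ⟨p - 1, by omega⟩
  set f := c⁻¹ • (X q p N .F ^ (p - 1) * u) with hf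
  have hfθ : f = c⁻¹ • θ (vec k p (p - 1)) := by rw [hθv]
  have hρf : ∀ w, ρ f w = w last • vec k p (p - 1) := by
    intro w
    have h : ρ u w = (w last * c) • vec k p 0 := by
      conv_lhs => rw [eq_sum_vec w]
      rw [map_sum, Finset.sum_eq_single last]
      · rw [map_smul, hP _ last.2, if_pos rfl, smul_smul]
      · intro i _ hi
        rw [map_smul, hP _ i.2, if_neg (fun h => hi (Fin.ext h)), smul_zero]
      · simp
    rw [hf, map_smul, LinearMap.smul_apply, map_mul, Module.End.mul_apply, h, map_smul, hF,
      smul_smul, mul_comm, mul_assoc, mul_inv_cancel₀ hc0, mul_one, zero_add]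
  have hfw : ∀ w, f * (c⁻¹ • θ w) = w last • f := by
    intro w
    rw [mul_smul_comm, ← hθ, hρf, map_smul, smul_comm, ← hfθ]
  have haf : ∀ a, a * f = c⁻¹ • θ (ρ a (vec k p (p - 1))) := by
    intro a
    rw [hfθ, mul_smul_comm, hθ]
  have hlast : vec k p (p - 1) last = 1 := by rw [vec_apply, if_pos rfl]
  refine ⟨f, ?_, ?_, fun a => ⟨ρ a (vec k p (p - 1)) last, ?_⟩, fun a ha => ?_⟩
  · intro h0
    have h1 := hρf (vec k p (p - 1))
    rw [h0, map_zero, LinearMap.zero_apply, hlast, one_smul] at h1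
    rw [← h1] at hlast
    exact zero_ne_one hlast
  · have h := hfw (vec k p (p - 1))
    rwa [← hfθ, hlast, one_smul] at h
  · rw [mul_assoc, haf, hfw]
  · set w := ρ a (vec k p (p - 1)) with hw
    obtain ⟨i, hi⟩ : ∃ i, w i ≠ 0 := by
      by_contra! h
      apply ha
      rw [haf, ← hw, show w = 0 from funext h, map_zero, smul_zero]
    refine ⟨(w i)⁻¹ • (f * X q p N .F ^ (p - 1 - i)), ?_⟩
    have hi' : ρ (X q p N .F ^ (p - 1 - i)) w last = w i := by
      conv_lhs => rw [eq_sum_vec w]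
      rw [map_sum, Finset.sum_apply, Finset.sum_eq_single i]
      · rw [map_smul, hF, Pi.smul_apply, vec_apply, if_pos (by change _ = p - 1; omega),
          smul_eq_mul, mul_one]
      · intro j _ hj
        rw [map_smul, hF, Pi.smul_apply, vec_apply, if_neg, smul_zero]
        intro h
        apply hj
        change _ = p - 1 at h
        exact Fin.ext (by omega)
      · simp
    rw [smul_mul_assoc, mul_assoc, haf, mul_smul_comm, ← hθ, hfw, hi', smul_smul,
      inv_mul_cancel₀ hi, one_smul]

end Steinberg

/-! ### The trivial character is not projective -/

/-- The highest weight module of weight `1` is a nonsplit extension of the trivial module, and no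
`y` can provide the splitting. -/
theorem not_exists_trivial_summand {k : Type*} [Field k] {q : k} {p N : ℕ} (hq : q ≠ 0)
    (hp2 : 2 ≤ p) (hp : IsPrimitiveRoot (q ^ 2) p) (hN : q ^ N = 1) :
    ∃ α : TruncatedQSl2 q p N →ₐ[k] k, ¬ ∃ y, α y = 1 ∧ ∀ a, a * y = α a • y := by
  obtain ⟨α, hαE, hαF, hαK, hαL⟩ := exists_character (q := q) (N := N) (e := p) (by omega)
  refine ⟨α, ?_⟩
  rintro ⟨y, hy1, hy⟩
  obtain ⟨ρ, hρ⟩ := exists_highestWeightModule (lam := (1 : k)) (N := N) hq (hp.ne_one (by omega))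
    hp.pow_eq_one (by rw [pow_right_comm, hN, one_pow]) one_ne_zero (one_pow _)
  let i0 : Fin p := ⟨0, by omega⟩
  let i1 : Fin p := ⟨1, by omega⟩
  -- The coefficient of the highest weight vector is a linear map to the trivial module.
  have hcoord := intertwines ρ ((Algebra.lmul k k).comp α) (LinearMap.proj i0) fun g v =>
    LinearMap.congr_fun (f := LinearMap.proj i0 ∘ₗ ρ (X q p N g))
      (g := (Algebra.lmul k k).comp α (X q p N g) ∘ₗ LinearMap.proj i0)
      (ext_vec fun n => by
        obtain ⟨h1, h2, h3, h4⟩ := hρ n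
        change ρ (X q p N g) (vec k p n) i0 = α (X q p N g) * vec k p n i0
        cases g with
        | E =>
          rw [h1, hαE, zero_mul, Pi.smul_apply, vec_apply]
          obtain rfl | rfl | h : n = 0 ∨ n = 1 ∨ 2 ≤ n := by omega
          · rw [raise_zero, zero_smul]
          · rw [raise_one_one q hq, zero_smul]
          · rw [if_neg (by change ¬ n - 1 = 0; omega), smul_zero]
        | F => rw [h2, hαF, zero_mul, vec_apply, if_neg (by change ¬ n + 1 = 0; omega)]
        | K =>
          rw [h3, hαK, Pi.smul_apply, vec_apply]
          split_ifs with h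
          · change n = 0 at h
            simp [h]
          · simp
        | Kinv =>
          rw [h4, hαL, Pi.smul_apply, vec_apply]
          split_ifs with h
          · change n = 0 at h
            simp [h]
          · simp) v
  have h0 : ρ y (vec k p 0) i0 = 1 := by
    have h := hcoord y (vec k p 0)
    change ρ y (vec k p 0) i0 = α y * vec k p 0 i0 at h
    rw [h, hy1, one_mul, vec_apply, if_pos rfl]
  have hF : ρ (X q p N .F) (ρ y (vec k p 0)) = 0 := by
    rw [← Module.End.mul_apply, ← map_mul, hy, hαF, zero_smul, map_zero, LinearMap.zero_apply]
  have h1 : ρ (X q p N .F) (ρ y (vec k p 0)) i1 = ρ y (vec k p 0) i0 := by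
    generalize ρ y (vec k p 0) = w
    conv_lhs => rw [eq_sum_vec w]
    rw [map_sum, Finset.sum_apply, Finset.sum_eq_single i0]
    · rw [map_smul, (hρ _).2.1, Pi.smul_apply, vec_apply, if_pos rfl, smul_eq_mul, mul_one]
    · intro j _ hj
      rw [map_smul, (hρ _).2.1, Pi.smul_apply, vec_apply, if_neg, smul_zero]
      intro h
      apply hj
      change _ = 1 at h
      exact Fin.ext (by change _ = 0; omega)
    · simp
  rw [hF, h0] at h1
  exact zero_ne_one h1

/-- Uniform version for both quantum groups: `E` and `F` are nilpotent of the order `p` of `q²`,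
and the eigenvalue `q` of `K` occurs. -/
theorem not_admitsHopfStructure {k : Type*} [Field k] {q : k} {p N : ℕ} (hp2 : 2 ≤ p)
    (hp : IsPrimitiveRoot (q ^ 2) p) (hN : q ^ N = 1) (hN0 : (N : k) ≠ 0)
    {B : Type*} [Ring B] [Algebra k B] (hB : IsBasicAlgebraOf k (TruncatedQSl2 q p N) B) :
    ¬ AdmitsHopfStructure k B := by
  rintro ⟨h, rfl⟩
  have hq : q ≠ 0 := by
    rintro rfl
    exact hp.ne_zero (by omega) (by simp)
  obtain ⟨f, hf0, hf, hcorner, hsimple⟩ := exists_steinberg_idempotent hq hp2 hp hN hN0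
  obtain ⟨α, hα⟩ := not_exists_trivial_summand hq hp2 hp hN
  exact hα (hB.exists_eigenvector hf0 hf hcorner hsimple α)

end QSl2

/-! ### Basic algebras of the two quantum groups -/

theorem proposition2p16 (k : Type*) [Field k] [IsAlgClosed k] [CharZero k]
    (B : Type*) [Ring B] [Algebra k B] :
    (∀ (q : k) (l : ℕ), 3 ≤ l → Odd l → IsPrimitiveRoot q l →
      IsBasicAlgebraOf k (SmallQuantumGroupSl2 q l) B → ¬ AdmitsHopfStructure k B) ∧
    (∀ (q : k) (p : ℕ), 2 ≤ p → IsPrimitiveRoot (q ^ 2) p →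
      IsBasicAlgebraOf k (RestrictedQuantumGroupSl2 q p) B → ¬ AdmitsHopfStructure k B) := by
  refine ⟨fun q l hl hodd hq hB => ?_, fun q p hp hq hB => ?_⟩
  · exact QSl2.not_admitsHopfStructure (by omega)
      (hq.pow_of_coprime 2 (Nat.coprime_two_left.2 hodd)) hq.pow_eq_one
      (Nat.cast_ne_zero.2 (by omega)) hB
  · exact QSl2.not_admitsHopfStructure hp hq (by rw [pow_mul, hq.pow_eq_one])
      (Nat.cast_ne_zero.2 (by omega)) hB
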